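/- Let $m,n\in\mathbb{N}$, let $f:\mathbb{R}^m\times\mathbb{R}^n\to\mathbb{R}^n$ be locally Lipschitz, let $g:\mathbb{R}^m\times\mathbb{R}^n\to\mathbb{R}^m$ be continuous and locally bounded, let $P\in\mathbb{R}^{n\times n}$ be symmetric positive definite, and let $\delta\ge 0$. Let $\mathcal{S}=\{x\in\mathbb{R}^n\mid h(x)\ge 0\}$, where $h:\mathbb{R}^n\to\mathbb{R}$ is continuously differentiable with locally Lipschitz gradient, and assume that $\mathcal{S}$ is nonempty and compact, that $\nabla h(x)\neq 0$ whenever $h(x)=0$, and that there is a continuous, strictly increasing, unbounded $\gamma:[0,\infty)\to\mathbb{R}$ with $\gamma(0)=0$ and $d(x,\partial\mathcal{S})\le\gamma(h(x))$ for all $x\in\mathcal{S}$. For $x\in\mathcal{S}$ let $T_{\mathcal{S}}(x)$ be the set of limits $\lim_i (x_i-x)/t_i$ with $x_i\in\mathcal{S}$, $x_i\to x$, $t_i>0$, $t_i\to0$, and let $N_{\mathcal{S}}(x)=\{\eta\mid \eta^\top v\le 0\ \ \forall v\in T_{\mathcal{S}}(x)\}$. Let $\mathbb{B}$ denote the closed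 Euclidean unit ball. Then the constrained differential inclusion $$\begin{bmatrix}\dot\zeta\\ \dot\xi\end{bmatrix}\in\begin{bmatrix} g(\zeta,\xi)\\ f(\zeta,\xi)-\big(P^{-1}N_{\mathcal{S}}(\xi)\cap\delta\mathbb{B}\big)\end{bmatrix},\qquad(\zeta,\xi)\in\mathbb{R}^m\times\mathcal{S},$$ is well-posed in the sense of Goebel, Sanfelice and Teel, i.e. in the following sense. A solution of an inclusion $\dot y\in F(y)$, $y\in C$, is a locally absolutely continuous function $\phi$ on an interval $\mathrm{dom}\,\phi$ of the form $[0,T]$ ($T\ge0$), $[0,T)$ ($T>0$) or $[0,\infty)$, with $\phi(0)\in\overline{C}$, $\phi(t)\in C$ for all $t$ in the interior of $\mathrm{dom}\,\phi$, and $\dot\phi(t)\in F(\phi(t))$ for almost all $t\in\mathrm{dom}\,\phi$; its length is $\sup\mathrm{dom}\,\phi$. It is maximal if it is not the restriction of a solution with a strictly larger domain. For $\rho\ge 0$, the $\rho$-perturbation of the inclusion has constraint set $C_\rho=\{x\mid (x+\rho(x)\mathbb{B})\cap C\ne\emptyset\}$ and right-hand side $F_\rho(x)=\overline{\mathrm{con}}\,F\big((x+\rho(x)\mathbb{B})\cap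 C\big)+\rho(x)\mathbb{B}$, where $\overline{\mathrm{con}}$ denotes the closed convex hull. A sequence of solutions $\phi_i$ converges graphically if their graphs converge (inner limit equals outer limit) to a set $M$. It is locally eventually bounded if for every $\tau>0$ there is a compact set $K$ such that, for all large $i$, $\phi_i(t)\in K$ for all $t\in\mathrm{dom}\,\phi_i$ with $t<\tau$. The inclusion is well-posed if, for every continuous $\rho\ge0$, every decreasing sequence $\varepsilon_i\in(0,1)$ with $\varepsilon_i\to0$, and every graphically convergent sequence of solutions $\phi_i$ of the $\varepsilon_i\rho$-perturbations with $\phi_i(0)\to y_0$ for some $y_0$, with limit graph $M$: (a) if $\{\phi_i\}$ is locally eventually bounded, then $M$ is the graph of a solution $\phi$ of the unperturbed inclusion, with $\phi(0)=y_0$ and $\mathrm{length}(\phi)=\lim_i\mathrm{length}(\phi_i)$; (b) if $\{\phi_i\}$ is not locally eventually bounded, then there is $T\in(0,\infty)$ such that the restriction of $M$ to times $t<T$ is the graph of a maximal solution $\phi$ of the unperturbed inclusion, with $\mathrm{length}(\phi)=T$ and $\lim_{t\to T^-}\|\phi(t)\|=\infty$. -/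

import Mathlib

open Set Filter Topology MeasureTheory
open scoped Pointwise

noncomputable section

/-! ### Constrained differential inclusions and their solutions -/

/-- The data of a constrained differential inclusion `ξ' ∈ F(ξ)`, `ξ ∈ C`. -/
structure DiffInclusion (E : Type*) where
  /-- the set-valued right-hand side -/
  F : E → Set E
  /-- the constraint set -/
  C : Set E

/-- An arc: a locally absolutely continuous function on an interval of the form `[0,T]` (with
`T ≥ 0`), `[0,T)` (with `T > 0`) or `[0,∞)`.  The values of `toFun` outside `dom` are
irrelevant. -/
structure Arc (E : Type*) [NormedAddCommGroup E] where
  dom : Set ℝ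
  toFun : ℝ → E
  zero_mem : (0 : ℝ) ∈ dom
  nonneg : ∀ t ∈ dom, 0 ≤ t
  ordConnected : dom.OrdConnected
  locallyAC : ∀ a b : ℝ, Icc a b ⊆ dom → a ≤ b → AbsolutelyContinuousOnInterval toFun a b

namespace Arc

variable {E : Type*} [NormedAddCommGroup E]

/-- The graph of an arc. -/
def graph (φ : Arc E) : Set (ℝ × E) := {p | p.1 ∈ φ.dom ∧ p.2 = φ.toFun p.1}

/-- The length of (the domain of) an arc, possibly `+∞`. -/
def length (φ : Arc E) : EReal := sSup ((fun t : ℝ => (t : EReal)) '' φ.dom)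

end Arc

namespace DiffInclusion

variable {E : Type*} [NormedAddCommGroup E] [NormedSpace ℝ E]

/-- (Carathéodory) solutions of a constrained differential inclusion. -/
def IsSolution (H : DiffInclusion E) (φ : Arc E) : Prop :=
  φ.toFun 0 ∈ closure H.C ∧
  (∀ t ∈ interior φ.dom, φ.toFun t ∈ H.C) ∧
  ∀ᵐ t : ℝ, t ∈ interior φ.dom → ∃ v ∈ H.F (φ.toFun t), HasDerivAt φ.toFun v t

/-- Maximal solutions: solutions which are not the restriction of a solution with a strictly
larger domain. -/
def IsMaximalSolution (H : DiffInclusion E) (φ : Arc E) : Prop :=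
  H.IsSolution φ ∧
  ∀ ψ : Arc E, H.IsSolution ψ → φ.dom ⊆ ψ.dom → EqOn φ.toFun ψ.toFun φ.dom → ψ.dom = φ.dom

/-- The `ρ`-perturbation of `ξ' ∈ F(ξ)`, `ξ ∈ C`, for a function `ρ ≥ 0` of the state:
`F_ρ(x) = closed convex hull of F((x + ρ(x)𝔹) ∩ C)  +  ρ(x)𝔹` and
`C_ρ = {x | (x + ρ(x)𝔹) ∩ C ≠ ∅}`. -/
def perturbation (H : DiffInclusion E) (ρ : E → ℝ) : DiffInclusion E where
  F := fun x =>
    closedConvexHull ℝ (⋃ y ∈ Metric.closedBall x (ρ x) ∩ H.C, H.F y)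
      + Metric.closedBall (0 : E) (ρ x)
  C := {x | (Metric.closedBall x (ρ x) ∩ H.C).Nonempty}

end DiffInclusion

/-! ### Set convergence, graphical convergence, well-posedness -/

/-- Painlevé–Kuratowski outer limit of a sequence of sets: all limits of subsequences
`x_k ∈ A (i_k)`. -/
def outerLimit {X : Type*} [TopologicalSpace X] (A : ℕ → Set X) : Set X :=
  {x | ∀ U ∈ 𝓝 x, ∃ᶠ i in atTop, (A i ∩ U).Nonempty}

/-- Painlevé–Kuratowski inner limit of a sequence of sets: all limits of sequences
`x_i ∈ A i`. -/
def innerLimit {X : Type*} [TopologicalSpace X] (A : ℕ → Set X) : Set X :=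
  {x | ∀ U ∈ 𝓝 x, ∀ᶠ i in atTop, (A i ∩ U).Nonempty}

section WellPosed

variable {E : Type*} [NormedAddCommGroup E]

/-- The sequence `φ` of arcs converges graphically to the set-valued map with graph `M`. -/
def GraphConverges (φ : ℕ → Arc E) (M : Set (ℝ × E)) : Prop :=
  outerLimit (fun i => (φ i).graph) = M ∧ innerLimit (fun i => (φ i).graph) = M

/-- Local eventual boundedness of a sequence of arcs. -/
def LocallyEventuallyBounded (φ : ℕ → Arc E) : Prop :=
  ∀ τ : ℝ, 0 < τ → ∃ K : Set E, IsCompact K ∧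
    ∀ᶠ i in atTop, ∀ t ∈ (φ i).dom, t < τ → (φ i).toFun t ∈ K

/-- Well-posedness in the sense of Goebel, Sanfelice and Teel, for a differential inclusion
(that is, a hybrid system without jumps): graphical limits of solutions of vanishing
perturbations are solutions of the unperturbed system. -/
def DiffInclusion.WellPosed [NormedSpace ℝ E] (H : DiffInclusion E) : Prop :=
  ∀ (ρ : E → ℝ), Continuous ρ → (∀ x, 0 ≤ ρ x) →
  ∀ (ε : ℕ → ℝ), Antitone ε → (∀ i, ε i ∈ Ioo (0 : ℝ) 1) → Tendsto ε atTop (𝓝 0) →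
  ∀ (φ : ℕ → Arc E), (∀ i, (H.perturbation (fun x => ε i * ρ x)).IsSolution (φ i)) →
  ∀ (M : Set (ℝ × E)), GraphConverges φ M →
  ∀ (ξ : E), Tendsto (fun i => (φ i).toFun 0) atTop (𝓝 ξ) →
    (LocallyEventuallyBounded φ →
      ∃ χ : Arc E, H.IsSolution χ ∧ χ.graph = M ∧ χ.toFun 0 = ξ ∧
        Tendsto (fun i => (φ i).length) atTop (𝓝 χ.length)) ∧
    (¬ LocallyEventuallyBounded φ →
      ∃ T : ℝ, 0 < T ∧ ∃ χ : Arc E, H.IsMaximalSolution χ ∧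
        χ.graph = M ∩ {p | p.1 < T} ∧ χ.length = (T : EReal) ∧
        Tendsto (fun t => ‖χ.toFun t‖) (𝓝[<] T) atTop)

end WellPosed

/-! ### Cones and the limiting differential inclusion -/

section Cones

variable {E : Type*} [NormedAddCommGroup E] [InnerProductSpace ℝ E]

/-- The (Bouligand) tangent cone to `S` at `x`. -/
def tangentCone (S : Set E) (x : E) : Set E :=
  {w | ∃ (y : ℕ → E) (t : ℕ → ℝ), (∀ i, y i ∈ S) ∧ (∀ i, 0 < t i) ∧
    Tendsto y atTop (𝓝 x) ∧ Tendsto t atTop (𝓝 0) ∧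
    Tendsto (fun i => (t i)⁻¹ • (y i - x)) atTop (𝓝 w)}

/-- The normal cone to `S` at `x`, the polar of the tangent cone. -/
def normalCone (S : Set E) (x : E) : Set E :=
  {η | ∀ v ∈ tangentCone S x, inner ℝ η v ≤ 0}

end Cones

/-- `γ : [0,∞) → ℝ` (represented by a function on `ℝ`) is of class `𝒦_∞`. -/
def IsClassKInfty (γ : ℝ → ℝ) : Prop :=
  ContinuousOn γ (Ici 0) ∧ γ 0 = 0 ∧ StrictMonoOn γ (Ici 0) ∧ Tendsto γ atTop atTop

/-- A function is locally bounded: every point has a neighbourhood with bounded image. -/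
def IsLocallyBounded {X Y : Type*} [TopologicalSpace X] [Bornology Y] (g : X → Y) : Prop :=
  ∀ x, ∃ U ∈ 𝓝 x, Bornology.IsBounded (g '' U)

/-- The standing assumption on `h : ℝⁿ → ℝ` and `S = {x | h x ≥ 0}`. -/
structure ConstraintAssumption {n : ℕ} (h : EuclideanSpace ℝ (Fin n) → ℝ)
    (S : Set (EuclideanSpace ℝ (Fin n))) : Prop where
  eq_superlevel : S = {x | 0 ≤ h x}
  nonempty : S.Nonempty
  compact : IsCompact S
  contDiff : ContDiff ℝ 1 h
  locallyLipschitz_gradient : LocallyLipschitz (gradient h)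
  gradient_ne_zero : ∀ x, h x = 0 → gradient h x ≠ 0
  exists_gauge : ∃ γ : ℝ → ℝ, IsClassKInfty γ ∧ ∀ x ∈ S, Metric.infDist x (frontier S) ≤ γ (h x)

/-- The set `v - (P⁻¹ N_S(x) ∩ d𝔹)`. -/
def truncatedNormalMap {n : ℕ} (P : Matrix (Fin n) (Fin n) ℝ)
    (S : Set (EuclideanSpace ℝ (Fin n))) (x v : EuclideanSpace ℝ (Fin n)) (d : ℝ) :
    Set (EuclideanSpace ℝ (Fin n)) :=
  {w | ∃ η ∈ (Matrix.toEuclideanLin P⁻¹ '' normalCone S x) ∩ Metric.closedBall 0 d, w = v - η}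

/-- The limiting differential inclusion
`(ζ', ξ') ∈ {g(ζ,ξ)} × (f(ζ,ξ) - P⁻¹ N_S(ξ) ∩ δ𝔹)`, `(ζ,ξ) ∈ ℝᵐ × S`, on `ℝᵐ × ℝⁿ` with its
Euclidean norm. -/
def limitDI {m n : ℕ}
    (g : EuclideanSpace ℝ (Fin m) × EuclideanSpace ℝ (Fin n) → EuclideanSpace ℝ (Fin m))
    (f : EuclideanSpace ℝ (Fin m) × EuclideanSpace ℝ (Fin n) → EuclideanSpace ℝ (Fin n))
    (P : Matrix (Fin n) (Fin n) ℝ) (S : Set (EuclideanSpace ℝ (Fin n))) (δ : ℝ) :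
    DiffInclusion (WithLp 2 (EuclideanSpace ℝ (Fin m) × EuclideanSpace ℝ (Fin n))) where
  F := fun p => {v | v.fst = g (p.fst, p.snd) ∧
    v.snd ∈ truncatedNormalMap P S p.snd (f (p.fst, p.snd)) δ}
  C := {p | p.snd ∈ S}

end

/-!
Well-posedness holds for every differential inclusion in a finite-dimensional space whose constraint
set `C` is closed and whose right-hand side `F` is, relative to `C`, outer semicontinuous, locally
bounded and convex-valued (`DiffInclusion.BasicConditions.wellPosed`), and the limiting inclusion
has these properties (`basicConditions_limitDI`).

For the general theorem, local boundedness of `F` bounds the speeds of the perturbed solutions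
uniformly on each ball. Before any time up to which the solutions are uniformly bounded they are
therefore equi-Lipschitz, so their graphical limit is single-valued and the convergence is locally
uniform. The limit is a solution
(`DiffInclusion.BasicConditions.isSolution_of_graph_subset`): near a point `x`, outer
semicontinuity puts the perturbed right-hand sides into a closed convex thickening of `F x`; by the
mean value inclusion (`AbsolutelyContinuousOnInterval.slope_mem_of_ae_hasDerivAt`) the short
difference quotients of the perturbed solutions lie in this thickening, and so do those of the
limit and, where it exists, the derivative of the limit. Letting the thickening shrink gives the
inclusion. If boundedness fails from a finite time `T` on, the limit must blow up at `T`: a bounded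
limit point at a time close to `T` would, by the speed bound, keep the perturbed solutions bounded
beyond `T` (`GraphConverges.exists_boundedBefore_add`).

For the limiting inclusion, the point is that the normal cone to `S = {h ≥ 0}` has closed graph
(`isClosed_graph_normalCone`). It is trivial where `h > 0`, and where `h = 0` its elements are the
nonpositive multiples of `∇h ≠ 0`, which vary continuously.
-/

/-! ### Absolutely continuous curves with constrained velocity -/

section MeanValue

variable {E : Type*} [NormedAddCommGroup E] [NormedSpace ℝ E]

theorem AbsolutelyContinuousOnInterval.continuousLinearMap_comp {f : ℝ → E} {a b : ℝ}
    (hf : AbsolutelyContinuousOnInterval f a b) (l : E →L[ℝ] ℝ) :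
    AbsolutelyContinuousOnInterval (fun t => l (f t)) a b := by
  have h0 : Tendsto (fun I : ℕ × (ℕ → ℝ × ℝ) =>
      ‖l‖ * ∑ i ∈ Finset.range I.1, dist (f (I.2 i).1) (f (I.2 i).2))
      (AbsolutelyContinuousOnInterval.totalLengthFilter ⊓
        𝓟 (AbsolutelyContinuousOnInterval.disjWithin a b)) (𝓝 0) := by
    simpa using Tendsto.const_mul ‖l‖ hf
  refine squeeze_zero (fun I => Finset.sum_nonneg fun i _ => dist_nonneg) (fun I => ?_) h0
  rw [Finset.mul_sum]
  exact Finset.sum_le_sum fun i _ => l.lipschitz.dist_le_mul _ _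

/-- Mean value inclusion: an absolutely continuous curve whose velocity lies a.e. in a closed convex
set `K` has its difference quotient in `K`. A point outside `K` is separated from it by a
functional, along which the scalar fundamental theorem of calculus applies. -/
theorem AbsolutelyContinuousOnInterval.slope_mem_of_ae_hasDerivAt {f : ℝ → E} {a b : ℝ}
    (hab : a < b) (hf : AbsolutelyContinuousOnInterval f a b) {K : Set E} (hK : Convex ℝ K)
    (hKc : IsClosed K) (hd : ∀ᵐ t : ℝ, t ∈ Ioo a b → ∃ v ∈ K, HasDerivAt f v t) :
    (b - a)⁻¹ • (f b - f a) ∈ K := by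
  by_contra hcon
  obtain ⟨l, u, hlK, hul⟩ := geometric_hahn_banach_closed_point hK hKc hcon
  have hlf := hf.continuousLinearMap_comp l
  have hle : ∫ t in a..b, deriv (fun t => l (f t)) t ≤ ∫ _t in a..b, u := by
    simp only [intervalIntegral.integral_of_le hab.le, integral_Ioc_eq_integral_Ioo]
    refine setIntegral_mono_ae_restrict
      (hlf.intervalIntegrable_deriv.1.mono_set Ioo_subset_Ioc_self) (by simp) ?_
    rw [EventuallyLE, ae_restrict_iff' measurableSet_Ioo]
    filter_upwards [hd] with t ht hmem
    obtain ⟨v, hvK, hv⟩ := ht hmem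
    have hlv : HasDerivAt (fun t => l (f t)) (l v) t := l.hasFDerivAt.comp_hasDerivAt t hv
    rw [hlv.deriv]
    exact (hlK v hvK).le
  have hba : 0 < b - a := sub_pos.2 hab
  rw [hlf.integral_deriv_eq_sub, intervalIntegral.integral_const, smul_eq_mul] at hle
  rw [map_smul, map_sub, smul_eq_mul, lt_inv_mul_iff₀ hba] at hul
  exact absurd hle (not_le.2 hul)

end MeanValue

namespace Arc

variable {E : Type*} [NormedAddCommGroup E] (φ : Arc E)

theorem Icc_subset_dom {s t : ℝ} (hs : s ∈ φ.dom) (ht : t ∈ φ.dom) : Icc s t ⊆ φ.dom :=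
  φ.ordConnected.out hs ht

theorem Ioo_subset_interior_dom {s t : ℝ} (hs : s ∈ φ.dom) (ht : t ∈ φ.dom) :
    Ioo s t ⊆ interior φ.dom :=
  interior_maximal (Ioo_subset_Icc_self.trans (φ.Icc_subset_dom hs ht)) isOpen_Ioo

theorem mem_dom_of_le {s t : ℝ} (hs : 0 ≤ s) (hst : s ≤ t) (ht : t ∈ φ.dom) : s ∈ φ.dom :=
  φ.Icc_subset_dom φ.zero_mem ht ⟨hs, hst⟩

theorem absolutelyContinuousOnInterval {s t : ℝ} (hs : s ∈ φ.dom) (ht : t ∈ φ.dom) (hst : s ≤ t) :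
    AbsolutelyContinuousOnInterval φ.toFun s t :=
  φ.locallyAC s t (φ.Icc_subset_dom hs ht) hst

theorem continuousOn_Icc {s t : ℝ} (hs : s ∈ φ.dom) (ht : t ∈ φ.dom) (hst : s ≤ t) :
    ContinuousOn φ.toFun (Icc s t) := by
  simpa [uIcc_of_le hst] using (φ.absolutelyContinuousOnInterval hs ht hst).continuousOn

variable {φ}

theorem length_le_of_notMem_dom {r : ℝ} (hr : 0 ≤ r)
    (h : r ∉ φ.dom) : φ.length ≤ r := by
  refine sSup_le ?_
  rintro _ ⟨t, ht, rfl⟩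
  by_contra! hlt
  exact h (φ.mem_dom_of_le hr (EReal.coe_lt_coe_iff.1 hlt).le ht)

variable [NormedSpace ℝ E]

theorem ae_differentiableAt [FiniteDimensional ℝ E] (φ : Arc E) :
    ∀ᵐ t : ℝ, t ∈ interior φ.dom → DifferentiableAt ℝ φ.toFun t := by
  have hbv : LocallyBoundedVariationOn φ.toFun φ.dom := by
    intro a b ha hb
    rcases le_total a b with hab | hba
    · refine (φ.absolutelyContinuousOnInterval ha hb hab).boundedVariationOn.mono ?_
      rw [uIcc_of_le hab]
      exact inter_subset_right
    · refine (φ.absolutelyContinuousOnInterval hb ha hba).boundedVariationOn.mono ?_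
      rw [uIcc_of_le hba]
      exact fun x hx => ⟨hba.trans hx.2.1, hx.2.2.trans hba⟩
  filter_upwards [hbv.ae_differentiableWithinAt_of_mem] with t ht hmem
  exact (ht (interior_subset hmem)).differentiableAt (mem_interior_iff_mem_nhds.1 hmem)

theorem norm_sub_le_of_speed_le {V s t : ℝ} (hs : s ∈ φ.dom) (ht : t ∈ φ.dom)
    (hst : s ≤ t)
    (hd : ∀ᵐ r : ℝ, r ∈ Ioo s t → ∃ v ∈ Metric.closedBall (0 : E) V, HasDerivAt φ.toFun v r) :
    ‖φ.toFun t - φ.toFun s‖ ≤ V * (t - s) := by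
  rcases hst.eq_or_lt with rfl | hlt
  · simp
  have h := (φ.absolutelyContinuousOnInterval hs ht hst).slope_mem_of_ae_hasDerivAt hlt
    (convex_closedBall 0 V) Metric.isClosed_closedBall hd
  have hpos : 0 < t - s := sub_pos.2 hlt
  rw [mem_closedBall_zero_iff, norm_smul, norm_inv, Real.norm_of_nonneg hpos.le,
    inv_mul_le_iff₀ hpos] at h
  linarith

/-- An arc whose speed is at most `V` as long as it stays in the ball of radius `R + 1` needs at
least time `1 / V` to leave that ball when it starts in the ball of radius `R`. -/
theorem norm_le_add_one_of_speed_le {R V s t : ℝ} (hV : 0 ≤ V)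
    (hd : ∀ᵐ r : ℝ, r ∈ interior φ.dom → ‖φ.toFun r‖ ≤ R + 1 →
      ∃ v ∈ Metric.closedBall (0 : E) V, HasDerivAt φ.toFun v r)
    (hs : s ∈ φ.dom) (ht : t ∈ φ.dom) (hst : s ≤ t) (hsR : ‖φ.toFun s‖ ≤ R)
    (hlt : V * (t - s) < 1) : ‖φ.toFun t‖ ≤ R + 1 := by
  by_contra! hcon
  -- the first time at which the norm reaches `R + 1`
  have hcomp : IsCompact (Icc s t ∩ (fun r => ‖φ.toFun r‖) ⁻¹' Ici (R + 1)) :=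
    isCompact_Icc.of_isClosed_subset
      ((φ.continuousOn_Icc hs ht hst).norm.preimage_isClosed_of_isClosed isClosed_Icc isClosed_Ici)
      inter_subset_left
  obtain ⟨r, ⟨hr, hrR⟩, hmin⟩ := hcomp.exists_isLeast ⟨t, ⟨hst, le_rfl⟩, hcon.le⟩
  have hrdom := φ.Icc_subset_dom hs ht hr
  have hle := norm_sub_le_of_speed_le (V := V) hs hrdom hr.1 (by
    filter_upwards [hd] with q hq hqmem
    refine hq (φ.Ioo_subset_interior_dom hs hrdom hqmem) ?_
    by_contra! hgt
    exact absurd (hmin ⟨⟨hqmem.1.le, hqmem.2.le.trans hr.2⟩, hgt.le⟩) (not_le.2 hqmem.2))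
  have h1 : V * (r - s) ≤ V * (t - s) := by gcongr; exact hr.2
  have h2 : ‖φ.toFun r‖ ≤ ‖φ.toFun r - φ.toFun s‖ + ‖φ.toFun s‖ := norm_le_norm_sub_add _ _
  have h3 : R + 1 ≤ ‖φ.toFun r‖ := hrR
  linarith

end Arc

/-! ### Sequences of arcs with locally bounded speed -/

section Sequences

variable {E : Type*} [NormedAddCommGroup E]

/-- The arcs `φ i` with `i` large are uniformly bounded on times before `τ`. -/
def BoundedBefore (φ : ℕ → Arc E) (τ : ℝ) : Prop :=
  ∃ R : ℝ, ∀ᶠ i in atTop, ∀ t ∈ (φ i).dom, t < τ → ‖(φ i).toFun t‖ ≤ R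

theorem BoundedBefore.mono {φ : ℕ → Arc E} {σ τ : ℝ} (h : BoundedBefore φ τ) (hst : σ ≤ τ) :
    BoundedBefore φ σ :=
  h.imp fun _ hR => hR.mono fun _ hi t ht hts => hi t ht (hts.trans_le hst)

theorem locallyEventuallyBounded_iff_boundedBefore [ProperSpace E] {φ : ℕ → Arc E} :
    LocallyEventuallyBounded φ ↔ ∀ τ, 0 < τ → BoundedBefore φ τ := by
  refine forall₂_congr fun τ _ => ⟨?_, ?_⟩
  · rintro ⟨K, hK, h⟩
    obtain ⟨R, hR⟩ := hK.isBounded.exists_norm_le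
    exact ⟨R, h.mono fun i hi t ht htτ => hR _ (hi t ht htτ)⟩
  · rintro ⟨R, h⟩
    exact ⟨Metric.closedBall 0 R, isCompact_closedBall 0 R,
      h.mono fun i hi t ht htτ => mem_closedBall_zero_iff.2 (hi t ht htτ)⟩

variable [NormedSpace ℝ E]

/-- The arcs `φ i` have speeds bounded uniformly in `i` as long as they stay in a given ball. -/
def HasLocallyBoundedSpeed (φ : ℕ → Arc E) : Prop :=
  ∀ R : ℝ, ∃ V : ℝ, 0 < V ∧ ∀ i, ∀ᵐ t : ℝ, t ∈ interior (φ i).dom → ‖(φ i).toFun t‖ ≤ R →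
    ∃ v ∈ Metric.closedBall (0 : E) V, HasDerivAt (φ i).toFun v t

theorem HasLocallyBoundedSpeed.exists_escape_time {φ : ℕ → Arc E} (h : HasLocallyBoundedSpeed φ)
    (R : ℝ) : ∃ κ > 0, ∀ i, ∀ s ∈ (φ i).dom, ‖(φ i).toFun s‖ ≤ R → ∀ t ∈ (φ i).dom, s ≤ t →
      t < s + κ → ‖(φ i).toFun t‖ ≤ R + 1 := by
  obtain ⟨V, hV, hd⟩ := h (R + 1)
  refine ⟨V⁻¹, inv_pos.2 hV, fun i s hs hsR t ht hst hlt => ?_⟩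
  refine Arc.norm_le_add_one_of_speed_le hV.le (hd i) hs ht hst hsR ?_
  rw [← lt_inv_mul_iff₀ hV]
  linarith

theorem BoundedBefore.exists_lipschitz {φ : ℕ → Arc E} {τ : ℝ} (hB : BoundedBefore φ τ)
    (h : HasLocallyBoundedSpeed φ) :
    ∃ V > 0, ∀ᶠ i in atTop, ∀ s ∈ (φ i).dom, s < τ → ∀ t ∈ (φ i).dom, t < τ →
      ‖(φ i).toFun t - (φ i).toFun s‖ ≤ V * |t - s| := by
  obtain ⟨R, hR⟩ := hB
  obtain ⟨V, hV, hd⟩ := h R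
  refine ⟨V, hV, hR.mono fun i hi => ?_⟩
  have key : ∀ s ∈ (φ i).dom, s < τ → ∀ t ∈ (φ i).dom, t < τ → s ≤ t →
      ‖(φ i).toFun t - (φ i).toFun s‖ ≤ V * |t - s| := by
    intro s hs _ t ht htτ hst
    rw [abs_of_nonneg (sub_nonneg.2 hst)]
    refine Arc.norm_sub_le_of_speed_le hs ht hst ?_
    filter_upwards [hd i] with r hr hmem
    exact hr ((φ i).Ioo_subset_interior_dom hs ht hmem)
      (hi r ((φ i).Icc_subset_dom hs ht (Ioo_subset_Icc_self hmem)) (hmem.2.trans htτ))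
  intro s hs hsτ t ht htτ
  rcases le_total s t with hst | hts
  · exact key s hs hsτ t ht htτ hst
  · rw [norm_sub_rev, abs_sub_comm]
    exact key t ht htτ s hs hsτ hts

end Sequences

/-! ### Regularity of the perturbed right-hand sides -/

section BasicConditions

variable {E : Type*} [NormedAddCommGroup E]

/-- The basic conditions on a differential inclusion: the constraint set is closed and, relative to
it, the right-hand side is outer semicontinuous (its graph is closed), locally bounded and
convex-valued. -/
structure DiffInclusion.BasicConditions [NormedSpace ℝ E] (H : DiffInclusion E) : Prop where
  isClosed_C : IsClosed H.C
  isClosed_graph : IsClosed {p : E × E | p.1 ∈ H.C ∧ p.2 ∈ H.F p.1}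
  convex_F : ∀ x ∈ H.C, Convex ℝ (H.F x)
  exists_bound : ∀ R : ℝ, ∃ V : ℝ, ∀ x ∈ H.C, ‖x‖ ≤ R → H.F x ⊆ Metric.closedBall 0 V

namespace DiffInclusion

variable [NormedSpace ℝ E] {H : DiffInclusion E}

theorem BasicConditions.isClosed_F (hH : H.BasicConditions) {x : E} (hx : x ∈ H.C) :
    IsClosed (H.F x) := by
  have h := hH.isClosed_graph.preimage (Continuous.prodMk_right x)
  simpa [hx] using h

theorem perturbation_F_subset {ρ : E → ℝ} {x : E} {K : Set E} (hK : Convex ℝ K)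
    (hKc : IsClosed K) (h : ∀ y ∈ H.C, dist y x ≤ ρ x → H.F y ⊆ K) :
    (H.perturbation ρ).F x ⊆ K + Metric.closedBall (0 : E) (ρ x) :=
  add_subset_add_right <| closedConvexHull_min
    (iUnion₂_subset fun y hy => h y hy.2 (Metric.mem_closedBall.1 hy.1)) hK hKc

/-- Points of vanishing perturbations of the constraint set accumulate only at points of its
closure. -/
theorem mem_closure_C_of_tendsto {ρ : E → ℝ} (hρ : Continuous ρ) {ε : ℕ → ℝ}
    (hε : Tendsto ε atTop (𝓝 0)) {z : ℕ → E} {x : E} (hz : Tendsto z atTop (𝓝 x))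
    (hmem : ∀ᶠ i in atTop, z i ∈ (H.perturbation (fun x => ε i * ρ x)).C) :
    x ∈ closure H.C := by
  rw [Metric.mem_closure_iff]
  intro η hη
  have h1 : Tendsto (fun i => ε i * ρ (z i) + dist (z i) x) atTop (𝓝 0) := by
    simpa using (hε.mul ((hρ.tendsto x).comp hz)).add (tendsto_iff_dist_tendsto_zero.1 hz)
  obtain ⟨i, hi, hlt⟩ := (hmem.and (h1.eventually_lt_const hη)).exists
  obtain ⟨y, hy, hyC⟩ := hi
  refine ⟨y, hyC, ?_⟩
  have h2 := dist_triangle x (z i) y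
  rw [dist_comm x (z i), dist_comm (z i) y] at h2
  have h3 : dist y (z i) ≤ ε i * ρ (z i) := hy
  linarith

variable [FiniteDimensional ℝ E]

/-- Upper semicontinuity of the right-hand side: by local boundedness a violating sequence of
velocities would accumulate, and by closedness of the graph its limit would be a value at `x`. -/
theorem BasicConditions.exists_F_subset_cthickening (hH : H.BasicConditions) {x : E} {η : ℝ}
    (hη : 0 < η) :
    ∃ r > 0, ∀ y ∈ H.C, dist y x < r → H.F y ⊆ Metric.cthickening η (H.F x) := by
  by_contra! hcon
  have hpos : ∀ k : ℕ, (0 : ℝ) < 1 / (k + 1) := fun k => by positivity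
  choose y hyC hyx hyF using fun k : ℕ => hcon _ (hpos k)
  choose v hvF hvn using fun k => not_subset.1 (hyF k)
  have hy : Tendsto y atTop (𝓝 x) := tendsto_iff_dist_tendsto_zero.2 <|
    squeeze_zero (fun _ => dist_nonneg) (fun k => (hyx k).le)
      tendsto_one_div_add_atTop_nhds_zero_nat
  obtain ⟨V, hV⟩ := hH.exists_bound (‖x‖ + 1)
  have hbd : ∀ k, v k ∈ Metric.closedBall (0 : E) V := fun k => by
    refine hV (y k) (hyC k) ?_ (hvF k)
    have h1 := (hyx k).le
    rw [dist_eq_norm] at h1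
    have h2 : (1 : ℝ) / (k + 1) ≤ 1 := by
      rw [div_le_one (by positivity)]
      linarith [(Nat.cast_nonneg k : (0 : ℝ) ≤ k)]
    have h3 := norm_le_norm_sub_add (y k) x
    linarith
  obtain ⟨w, -, σ, hσ, hw⟩ := (isCompact_closedBall (0 : E) V).tendsto_subseq hbd
  have hmem := hH.isClosed_graph.mem_of_tendsto
    ((hy.comp hσ.tendsto_atTop).prodMk_nhds hw) (.of_forall fun k => ⟨hyC _, hvF _⟩)
  obtain ⟨k, hk⟩ := (hw.eventually (Metric.ball_mem_nhds w hη)).exists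
  refine hvn (σ k) (Metric.mem_cthickening_of_dist_le _ w _ _ hmem.2 (le_of_lt hk))

/-- Since `ρ` is bounded near `x`, for small `ε` the `ε ρ`-perturbation at points near `x` only sees
values of `F` near `x` and inflates them slightly. The thickening is closed and convex, so the
closed convex hull does not leave it. -/
theorem BasicConditions.exists_perturbation_F_subset_cthickening (hH : H.BasicConditions)
    {ρ : E → ℝ} (hρ : Continuous ρ) (hρ0 : ∀ x, 0 ≤ ρ x) {x : E} (hx : x ∈ H.C) {η : ℝ}
    (hη : 0 < η) :
    ∃ r > 0, ∀ ε ∈ Ioo 0 r, ∀ z, dist z x < r →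
      (H.perturbation (fun y => ε * ρ y)).F z ⊆ Metric.cthickening η (H.F x) := by
  obtain ⟨r₁, hr₁, hF⟩ := hH.exists_F_subset_cthickening (x := x) (half_pos hη)
  obtain ⟨r₂, hr₂, hρx⟩ := Metric.continuous_iff.1 hρ x 1 one_pos
  have hc : 0 < ρ x + 1 := by linarith [hρ0 x]
  have hm : 0 < min (η / 2) (r₁ / 2) := by positivity
  refine ⟨min (min (r₁ / 2) r₂) (min (η / 2) (r₁ / 2) / (ρ x + 1)), by positivity, ?_⟩
  intro ε hε z hz
  have hz1 : dist z x < r₁ / 2 := hz.trans_le ((min_le_left _ _).trans (min_le_left _ _))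
  have hz2 : dist z x < r₂ := hz.trans_le ((min_le_left _ _).trans (min_le_right _ _))
  have hρz : ρ z ≤ ρ x + 1 := by
    have := hρx z hz2
    rw [Real.dist_eq] at this
    linarith [(abs_lt.1 this).2]
  have hle : ε * ρ z ≤ min (η / 2) (r₁ / 2) := by
    have h1 : ε ≤ min (η / 2) (r₁ / 2) / (ρ x + 1) := (hε.2.trans_le (min_le_right _ _)).le
    rw [le_div_iff₀ hc] at h1
    exact (mul_le_mul_of_nonneg_left hρz hε.1.le).trans h1
  refine (perturbation_F_subset ((hH.convex_F x hx).cthickening (η / 2))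
    Metric.isClosed_cthickening fun y hy hyz => hF y hy ?_).trans ?_
  · have h1 : dist y z ≤ r₁ / 2 := hyz.trans (hle.trans (min_le_right _ _))
    linarith [dist_triangle y z x]
  · rintro _ ⟨u, hu, w, hw, rfl⟩
    have h1 : Metric.infEDist (u + w) (H.F x) ≤ ENNReal.ofReal η := by
      refine Metric.infEDist_le_edist_add_infEDist.trans ((add_le_add
        (?_ : edist (u + w) u ≤ ENNReal.ofReal (η / 2)) (Metric.mem_cthickening_iff.1 hu)).trans ?_)
      · rw [edist_dist]
        refine ENNReal.ofReal_le_ofReal ?_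
        rw [dist_eq_norm, add_sub_cancel_left]
        exact (mem_closedBall_zero_iff.1 hw).trans (hle.trans (min_le_left _ _))
      · rw [← ENNReal.ofReal_add (by positivity) (by positivity), add_halves]
    exact Metric.mem_cthickening_iff.2 h1

theorem BasicConditions.exists_perturbation_F_bound (hH : H.BasicConditions)
    {ρ : E → ℝ} (hρ : Continuous ρ) (hρ0 : ∀ x, 0 ≤ ρ x) (R : ℝ) :
    ∃ V > 0, ∀ ε ∈ Ioo (0 : ℝ) 1, ∀ x, ‖x‖ ≤ R →
      (H.perturbation (fun y => ε * ρ y)).F x ⊆ Metric.closedBall 0 V := by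
  obtain ⟨Q, hQ⟩ := (isCompact_closedBall (0 : E) R).exists_bound_of_continuousOn hρ.continuousOn
  obtain ⟨V, hV⟩ := hH.exists_bound (R + Q)
  refine ⟨max (V + Q) 1, by positivity, fun ε hε x hx => ?_⟩
  have hle : ε * ρ x ≤ Q := by
    have h1 := hQ x (mem_closedBall_zero_iff.2 hx)
    rw [Real.norm_of_nonneg (hρ0 x)] at h1
    exact (mul_le_of_le_one_left (hρ0 x) hε.2.le).trans h1
  refine (perturbation_F_subset (convex_closedBall 0 V) Metric.isClosed_closedBall
    fun y hy hyx => hV y hy ?_).trans ?_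
  · have h1 : ‖y - x‖ ≤ Q := by
      rw [← dist_eq_norm]
      exact hyx.trans hle
    linarith [norm_le_norm_sub_add y x]
  · rintro _ ⟨u, hu, w, hw, rfl⟩
    rw [mem_closedBall_zero_iff] at hu hw ⊢
    exact (norm_add_le u w).trans ((add_le_add hu (hw.trans hle)).trans (le_max_left _ _))

theorem BasicConditions.hasLocallyBoundedSpeed (hH : H.BasicConditions)
    {ρ : E → ℝ} (hρ : Continuous ρ) (hρ0 : ∀ x, 0 ≤ ρ x) {ε : ℕ → ℝ}
    (hε : ∀ i, ε i ∈ Ioo (0 : ℝ) 1) {φ : ℕ → Arc E}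
    (hφ : ∀ i, (H.perturbation (fun x => ε i * ρ x)).IsSolution (φ i)) :
    HasLocallyBoundedSpeed φ := by
  intro R
  obtain ⟨V, hV, h⟩ := hH.exists_perturbation_F_bound hρ hρ0 R
  refine ⟨V, hV, fun i => ?_⟩
  filter_upwards [(hφ i).2.2] with t ht hmem hR
  obtain ⟨v, hv, hd⟩ := ht hmem
  exact ⟨v, h (ε i) (hε i) _ hR hv, hd⟩

end DiffInclusion

end BasicConditions

/-! ### Graphical limits of arcs with locally bounded speed -/

namespace GraphConverges

variable {E : Type*} [NormedAddCommGroup E] {φ : ℕ → Arc E} {M : Set (ℝ × E)}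

theorem eventually_exists_near (hM : GraphConverges φ M) {t : ℝ} {x : E} (h : (t, x) ∈ M) {r : ℝ}
    (hr : 0 < r) :
    ∀ᶠ i in atTop, ∃ s ∈ (φ i).dom, |s - t| < r ∧ ‖(φ i).toFun s - x‖ < r := by
  rw [← hM.2] at h
  refine (h _ (Metric.ball_mem_nhds _ hr)).mono ?_
  rintro i ⟨⟨s, z⟩, ⟨hs, hz⟩, hsx⟩
  obtain rfl : z = (φ i).toFun s := hz
  rw [Metric.mem_ball, Prod.dist_eq, max_lt_iff] at hsx
  exact ⟨s, hs, hsx.1, by simpa [dist_eq_norm] using hsx.2⟩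

theorem nonneg (hM : GraphConverges φ M) {t : ℝ} {x : E} (h : (t, x) ∈ M) : 0 ≤ t := by
  by_contra! ht
  obtain ⟨i, s, hs, hst, -⟩ := (hM.eventually_exists_near h (neg_pos.2 ht)).exists
  linarith [(abs_lt.1 hst).2, (φ i).nonneg s hs]

theorem zero_mem (hM : GraphConverges φ M) {ξ : E}
    (hξ : Tendsto (fun i => (φ i).toFun 0) atTop (𝓝 ξ)) : ((0 : ℝ), ξ) ∈ M := by
  rw [← hM.2]
  intro U hU
  have h0 : Tendsto (fun i => ((0 : ℝ), (φ i).toFun 0)) atTop (𝓝 (0, ξ)) :=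
    tendsto_const_nhds.prodMk_nhds hξ
  exact (h0.eventually hU).mono fun i hi => ⟨_, ⟨(φ i).zero_mem, rfl⟩, hi⟩

theorem eventually_mem_dom (hM : GraphConverges φ M) {s t : ℝ} {x : E} (h : (t, x) ∈ M)
    (hs : 0 ≤ s) (hst : s < t) : ∀ᶠ i in atTop, s ∈ (φ i).dom := by
  refine (hM.eventually_exists_near h (sub_pos.2 hst)).mono ?_
  rintro i ⟨r, hr, hrt, -⟩
  exact (φ i).mem_dom_of_le hs (by linarith [(abs_lt.1 hrt).1]) hr

/-- The graphical limit has a point over every time that lies in infinitely many of the domains and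
before which the arcs are bounded. -/
theorem exists_mem_of_frequently_mem_dom [ProperSpace E] (hM : GraphConverges φ M) {t τ : ℝ}
    (hB : BoundedBefore φ τ) (htτ : t < τ) (hfr : ∃ᶠ i in atTop, t ∈ (φ i).dom) :
    ∃ x, (t, x) ∈ M := by
  obtain ⟨R, hR⟩ := hB
  obtain ⟨σ, hσ, hP⟩ := extraction_forall_of_frequently fun _ : ℕ => hfr.and_eventually hR
  have hbd : ∀ k, (φ (σ k)).toFun t ∈ Metric.closedBall (0 : E) R := fun k =>
    mem_closedBall_zero_iff.2 ((hP k).2 t (hP k).1 htτ)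
  obtain ⟨x, -, ψ, hψ, hx⟩ := (isCompact_closedBall (0 : E) R).tendsto_subseq hbd
  refine ⟨x, ?_⟩
  rw [← hM.1]
  intro U hU
  have hlim := ((tendsto_const_nhds (x := t)).prodMk_nhds hx).eventually hU
  refine (hσ.comp hψ).tendsto_atTop.frequently (hlim.mono fun k hk => ?_).frequently
  exact ⟨(t, (φ (σ (ψ k))).toFun t), ⟨(hP (ψ k)).1, rfl⟩, hk⟩

variable [NormedSpace ℝ E]

theorem exists_lipschitz (hM : GraphConverges φ M) (hφ : HasLocallyBoundedSpeed φ) {τ : ℝ}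
    (hB : BoundedBefore φ τ) :
    ∃ V > 0, ∀ s x t y, (s, x) ∈ M → (t, y) ∈ M → s < τ → t < τ → ‖y - x‖ ≤ V * |t - s| := by
  obtain ⟨V, hV, hlip⟩ := hB.exists_lipschitz hφ
  refine ⟨V, hV, fun s x t y hs ht hsτ htτ => le_of_forall_pos_lt_add fun η hη => ?_⟩
  have hr : 0 < min (min (τ - s) (τ - t)) (η / (2 * V + 2)) :=
    lt_min (lt_min (sub_pos.2 hsτ) (sub_pos.2 htτ)) (by positivity)
  set r := min (min (τ - s) (τ - t)) (η / (2 * V + 2))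
  obtain ⟨i, ⟨hi, s', hs', hss, hsx⟩, t', ht', htt, hty⟩ :=
    ((hlip.and (hM.eventually_exists_near hs hr)).and (hM.eventually_exists_near ht hr)).exists
  have hrs : r ≤ τ - s := (min_le_left _ _).trans (min_le_left _ _)
  have hrt : r ≤ τ - t := (min_le_left _ _).trans (min_le_right _ _)
  have hrη : r * (2 * V + 2) ≤ η := (le_div_iff₀ (by positivity)).1 (min_le_right _ _)
  rw [abs_lt] at hss htt
  have h1 := hi s' hs' (by linarith) t' ht' (by linarith)
  have h2 : |t' - s'| ≤ |t - s| + 2 * r := by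
    have h3 := neg_abs_le (t - s)
    have h4 := le_abs_self (t - s)
    exact abs_le.2 ⟨by linarith, by linarith⟩
  have h5 : V * |t' - s'| ≤ V * (|t - s| + 2 * r) := by gcongr
  have h6 : ‖y - x‖ ≤ ‖(φ i).toFun t' - y‖ + ‖(φ i).toFun t' - (φ i).toFun s'‖ +
      ‖(φ i).toFun s' - x‖ := by
    have h7 : y - x = -((φ i).toFun t' - y) + ((φ i).toFun t' - (φ i).toFun s') +
      ((φ i).toFun s' - x) := by abel
    rw [h7, ← norm_neg ((φ i).toFun t' - y)]
    exact norm_add₃_le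
  linarith

theorem eq_of_mem_of_mem (hM : GraphConverges φ M) (hφ : HasLocallyBoundedSpeed φ) {t τ : ℝ}
    (hB : BoundedBefore φ τ) (htτ : t < τ) {x y : E} (hx : (t, x) ∈ M) (hy : (t, y) ∈ M) :
    x = y := by
  obtain ⟨V, -, h⟩ := hM.exists_lipschitz hφ hB
  have := h t y t x hy hx htτ htτ
  rw [sub_self, abs_zero, mul_zero] at this
  exact sub_eq_zero.1 (norm_le_zero_iff.1 this)

/-- Near `t`, graphical convergence of arcs with locally bounded speed is uniform convergence. -/
theorem exists_eventually_norm_sub_lt (hM : GraphConverges φ M) (hφ : HasLocallyBoundedSpeed φ)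
    {t τ : ℝ} (hB : BoundedBefore φ τ) (htτ : t < τ) {x : E} (hx : (t, x) ∈ M) {η : ℝ}
    (hη : 0 < η) :
    ∃ r > 0, ∀ᶠ i in atTop, ∀ s ∈ (φ i).dom, |s - t| < r → ‖(φ i).toFun s - x‖ < η := by
  obtain ⟨V, hV, hlip⟩ := hB.exists_lipschitz hφ
  have hr : 0 < min (τ - t) (η / (2 * V + 1)) := lt_min (sub_pos.2 htτ) (by positivity)
  set r := min (τ - t) (η / (2 * V + 1))
  refine ⟨r, hr, (hlip.and (hM.eventually_exists_near hx hr)).mono ?_⟩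
  rintro i ⟨hi, q, hq, hqt, hqx⟩ s hs hst
  have hrt : r ≤ τ - t := min_le_left _ _
  have hrη : r * (2 * V + 1) ≤ η := (le_div_iff₀ (by positivity)).1 (min_le_right _ _)
  rw [abs_lt] at hqt hst
  have h1 := hi q hq (by linarith) s hs (by linarith)
  have h2 : |s - q| ≤ 2 * r := abs_le.2 ⟨by linarith, by linarith⟩
  have h3 : V * |s - q| ≤ V * (2 * r) := by gcongr
  have h4 := norm_sub_le_norm_sub_add_norm_sub ((φ i).toFun s) ((φ i).toFun q) x
  linarith

theorem tendsto_toFun (hM : GraphConverges φ M) (hφ : HasLocallyBoundedSpeed φ)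
    {t τ : ℝ} (hB : BoundedBefore φ τ) (htτ : t < τ) {x : E} (hx : (t, x) ∈ M)
    (hdom : ∀ᶠ i in atTop, t ∈ (φ i).dom) :
    Tendsto (fun i => (φ i).toFun t) atTop (𝓝 x) := by
  refine Metric.tendsto_nhds.2 fun η hη => ?_
  obtain ⟨r, hr, h⟩ := hM.exists_eventually_norm_sub_lt hφ hB htτ hx hη
  filter_upwards [h, hdom] with i hi hdi
  rw [dist_eq_norm]
  exact hi t hdi (by simpa using hr)

/-- If the arcs are bounded up to some time after `t` and the graphical limit has a point over `t`,
then the arcs are bounded up to time `t + κ`, where `κ > 0` depends only on a bound for the norm of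
this point. -/
theorem exists_boundedBefore_add (hM : GraphConverges φ M) (hφ : HasLocallyBoundedSpeed φ)
    (R : ℝ) : ∃ κ > 0, ∀ t x τ, (t, x) ∈ M → ‖x‖ ≤ R → BoundedBefore φ τ → t < τ →
      BoundedBefore φ (t + κ) := by
  obtain ⟨κ, hκ, hesc⟩ := hφ.exists_escape_time (R + 1)
  refine ⟨κ / 2, half_pos hκ, ?_⟩
  rintro t x τ hx hxR ⟨Q, hQ⟩ htτ
  have hr : 0 < min (min (κ / 2) 1) (τ - t) :=
    lt_min (lt_min (half_pos hκ) one_pos) (sub_pos.2 htτ)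
  refine ⟨max Q (R + 2), (hQ.and (hM.eventually_exists_near hx hr)).mono ?_⟩
  rintro i ⟨hi, s, hs, hst, hsx⟩ u hu hut
  simp only [lt_min_iff] at hst hsx
  have h1 := abs_lt.1 hst.1.1
  have h2 := abs_lt.1 hst.2
  rcases le_total u s with hus | hsu
  · exact (hi u hu (by linarith)).trans (le_max_left _ _)
  · refine le_trans ?_ (le_max_right _ _)
    have h3 := norm_le_norm_sub_add ((φ i).toFun s) x
    have h4 := hesc i s hs (by linarith [hsx.1.2]) u hu hsu (by linarith)
    linarith

/-- The arc traced by a graphical limit over an interval of times before which the sequence stays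
bounded. -/
theorem exists_arc (hM : GraphConverges φ M) (hφ : HasLocallyBoundedSpeed φ)
    {D : Set ℝ} (h0 : (0 : ℝ) ∈ D) (hD : D.OrdConnected) (hfib : ∀ t ∈ D, ∃ x, (t, x) ∈ M)
    (hB : ∀ t ∈ D, ∃ τ, t < τ ∧ BoundedBefore φ τ) :
    ∃ χ : Arc E, χ.dom = D ∧ χ.graph = M ∩ {p | p.1 ∈ D} := by
  choose! X hX using hfib
  refine ⟨⟨D, X, h0, fun t ht => hM.nonneg (hX t ht), hD, fun a b hab hle => ?_⟩, rfl, ?_⟩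
  · obtain ⟨τ, hbτ, hBτ⟩ := hB b (hab (right_mem_Icc.2 hle))
    obtain ⟨V, hV, h⟩ := hM.exists_lipschitz hφ hBτ
    refine LipschitzOnWith.absolutelyContinuousOnInterval (K := V.toNNReal) ?_
    refine LipschitzOnWith.of_dist_le_mul fun t ht s hs => ?_
    rw [uIcc_of_le hle] at ht hs
    rw [Real.coe_toNNReal _ hV.le, dist_eq_norm, Real.dist_eq]
    exact h s _ t _ (hX s (hab hs)) (hX t (hab ht)) (hs.2.trans_lt hbτ) (ht.2.trans_lt hbτ)
  · ext ⟨t, x⟩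
    refine ⟨?_, ?_⟩
    · rintro ⟨ht, hx⟩
      obtain rfl : x = X t := hx
      exact ⟨hX t ht, ht⟩
    · rintro ⟨hx, ht⟩
      obtain ⟨τ, htτ, hBτ⟩ := hB t ht
      exact ⟨ht, hM.eq_of_mem_of_mem hφ hBτ htτ hx (hX t ht)⟩

end GraphConverges

/-! ### Well-posedness from the basic conditions -/

namespace DiffInclusion

variable {E : Type*} [NormedAddCommGroup E] [NormedSpace ℝ E] [FiniteDimensional ℝ E]
  {H : DiffInclusion E} {ρ : E → ℝ} {ε : ℕ → ℝ} {φ : ℕ → Arc E} {M : Set (ℝ × E)}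

/-- An arc inside the graphical limit of solutions of vanishing perturbations solves the limiting
inclusion. At a time where the limit is differentiable, the difference quotients of the `φ i` over
short intervals lie in a thickening of `F` by the mean value inclusion, hence so does the
derivative of the limit; no convergence of velocities is needed. -/
theorem BasicConditions.isSolution_of_graph_subset (hH : H.BasicConditions)
    (hρ : Continuous ρ) (hρ0 : ∀ x, 0 ≤ ρ x) (hε : ∀ i, ε i ∈ Ioo (0 : ℝ) 1)
    (hε0 : Tendsto ε atTop (𝓝 0))
    (hφ : ∀ i, (H.perturbation (fun x => ε i * ρ x)).IsSolution (φ i))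
    (hM : GraphConverges φ M) {χ : Arc E} (hχ : χ.graph ⊆ M)
    (hB : ∀ t ∈ χ.dom, ∃ τ, t < τ ∧ BoundedBefore φ τ) : H.IsSolution χ := by
  have hspeed := hH.hasLocallyBoundedSpeed hρ hρ0 hε hφ
  have hgr : ∀ t ∈ χ.dom, (t, χ.toFun t) ∈ M := fun t ht => hχ ⟨ht, rfl⟩
  have htend : ∀ t ∈ χ.dom, (∀ᶠ i in atTop, t ∈ (φ i).dom) →
      Tendsto (fun i => (φ i).toFun t) atTop (𝓝 (χ.toFun t)) := fun t ht hdom => by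
    obtain ⟨τ, htτ, hBτ⟩ := hB t ht
    exact hM.tendsto_toFun hspeed hBτ htτ (hgr t ht) hdom
  -- short intervals after an interior time of `χ.dom` are eventually interior to every domain
  have hint : ∀ t ∈ interior χ.dom, ∃ r > 0, Icc t (t + r) ⊆ χ.dom ∧
      ∀ s ∈ Icc t (t + r), ∀ᶠ i in atTop, s ∈ interior (φ i).dom := by
    intro t ht
    obtain ⟨r, hr, hball⟩ := Metric.mem_nhds_iff.1 (mem_interior_iff_mem_nhds.1 ht)
    have hdom : ∀ s, |s - t| < r → s ∈ χ.dom := fun s hs => hball hs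
    have hneg := χ.nonneg _ (hdom (t - r / 2) (abs_lt.2 ⟨by linarith, by linarith⟩))
    refine ⟨r / 4, by positivity, fun s hs => hdom s ?_, fun s hs => ?_⟩
    · exact abs_lt.2 ⟨by linarith [hs.1], by linarith [hs.2]⟩
    · have hlim := hgr _ (hdom (t + r / 2) (abs_lt.2 ⟨by linarith, by linarith⟩))
      refine (hM.eventually_mem_dom hlim (s := t + r / 3) (by linarith)
        (by linarith)).mono fun i hi => ?_
      exact (φ i).Ioo_subset_interior_dom (φ i).zero_mem hi
        ⟨by linarith [hs.1], by linarith [hs.2]⟩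
  have hmemC : ∀ t ∈ interior χ.dom, χ.toFun t ∈ H.C := fun t ht => by
    obtain ⟨r, hr, -, hev⟩ := hint t ht
    have hti := hev t ⟨le_rfl, by linarith⟩
    rw [← hH.isClosed_C.closure_eq]
    exact mem_closure_C_of_tendsto hρ hε0 (htend t (interior_subset ht)
      (hti.mono fun i hi => interior_subset hi)) (hti.mono fun i hi => (hφ i).2.1 t hi)
  refine ⟨?_, hmemC, ?_⟩
  -- the initial values `φ i 0` are only limits of points of the perturbed constraint sets
  · choose z hzC hz using fun i => Metric.mem_closure_iff.1 (hφ i).1 (1 / ((i : ℝ) + 1))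
      (by positivity)
    refine mem_closure_C_of_tendsto hρ hε0 (z := z) ?_ (.of_forall hzC)
    refine (htend 0 χ.zero_mem (.of_forall fun i => (φ i).zero_mem)).congr_dist ?_
    exact squeeze_zero (fun _ => dist_nonneg) (fun i => (hz i).le)
      tendsto_one_div_add_atTop_nhds_zero_nat
  · filter_upwards [χ.ae_differentiableAt] with t hdiff ht
    have hd := (hdiff ht).hasDerivAt
    refine ⟨_, ?_, hd⟩
    have hx := hmemC t ht
    rw [← (hH.isClosed_F hx).closure_eq, Metric.closure_eq_iInter_cthickening]
    refine mem_iInter₂.2 fun η hη => ?_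
    obtain ⟨r, hr, hdom, hev⟩ := hint t ht
    obtain ⟨τ, htτ, hBτ⟩ := hB t (interior_subset ht)
    obtain ⟨r₁, hr₁, hF⟩ := hH.exists_perturbation_F_subset_cthickening hρ hρ0 hx hη
    obtain ⟨r₂, hr₂, hnear⟩ := hM.exists_eventually_norm_sub_lt hspeed hBτ htτ
      (hgr t (interior_subset ht)) hr₁
    have hslope : ∀ s ∈ Ioo t (t + min r r₂),
        slope χ.toFun t s ∈ Metric.cthickening η (H.F (χ.toFun t)) := by
      intro s hs
      have hsr : s ≤ t + r := by linarith [hs.2, min_le_left r r₂]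
      have hsr₂ : s < t + r₂ := by linarith [hs.2, min_le_right r r₂]
      have hti := hev t ⟨le_rfl, by linarith⟩
      have hsi := hev s ⟨hs.1.le, hsr⟩
      have hlim : Tendsto (fun i => (s - t)⁻¹ • ((φ i).toFun s - (φ i).toFun t)) atTop
          (𝓝 (slope χ.toFun t s)) :=
        ((htend s (hdom ⟨hs.1.le, hsr⟩) (hsi.mono fun i hi => interior_subset hi)).sub
          (htend t (interior_subset ht) (hti.mono fun i hi => interior_subset hi))).const_smul _
      refine Metric.isClosed_cthickening.mem_of_tendsto hlim ?_
      filter_upwards [hti, hsi, hnear, hε0.eventually_lt_const hr₁] with i hit his hni hεi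
      have htd := interior_subset hit
      have hsd := interior_subset his
      refine ((φ i).absolutelyContinuousOnInterval htd hsd
        hs.1.le).slope_mem_of_ae_hasDerivAt hs.1 ((hH.convex_F _ hx).cthickening η)
        Metric.isClosed_cthickening ?_
      filter_upwards [(hφ i).2.2] with q hq hqmem
      have hqi := (φ i).Ioo_subset_interior_dom htd hsd hqmem
      obtain ⟨v, hv, hvd⟩ := hq hqi
      refine ⟨v, hF (ε i) ⟨(hε i).1, hεi⟩ _ ?_ hv, hvd⟩
      rw [dist_eq_norm]
      exact hni q (interior_subset hqi) (abs_lt.2 ⟨by linarith [hqmem.1], by linarith [hqmem.2]⟩)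
    have hpos : 0 < min r r₂ := lt_min hr hr₂
    refine Metric.isClosed_cthickening.mem_of_tendsto
      (hd.tendsto_slope.mono_left (nhdsGT_le_nhdsNE t)) ?_
    filter_upwards [Ioo_mem_nhdsGT (show t < t + min r r₂ by linarith)] with s hs
    exact hslope s hs

/-- Without escape, the graphical limit is traced by a solution over the projection of the limit
graph to the time axis, and the domains converge to this projection. -/
theorem BasicConditions.exists_isSolution_of_locallyEventuallyBounded (hH : H.BasicConditions)
    (hρ : Continuous ρ) (hρ0 : ∀ x, 0 ≤ ρ x) (hε : ∀ i, ε i ∈ Ioo (0 : ℝ) 1)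
    (hε0 : Tendsto ε atTop (𝓝 0))
    (hφ : ∀ i, (H.perturbation (fun x => ε i * ρ x)).IsSolution (φ i))
    (hM : GraphConverges φ M) {ξ : E} (hξ : Tendsto (fun i => (φ i).toFun 0) atTop (𝓝 ξ))
    (hleb : LocallyEventuallyBounded φ) :
    ∃ χ : Arc E, H.IsSolution χ ∧ χ.graph = M ∧ χ.toFun 0 = ξ ∧
      Tendsto (fun i => (φ i).length) atTop (𝓝 χ.length) := by
  have hspeed := hH.hasLocallyBoundedSpeed hρ hρ0 hε hφ
  rw [locallyEventuallyBounded_iff_boundedBefore] at hleb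
  have hB : ∀ t, ∃ τ, t < τ ∧ BoundedBefore φ τ := fun t =>
    ⟨max t 0 + 1, by linarith [le_max_left t 0], hleb _ (by linarith [le_max_right t 0])⟩
  have hfib : ∀ t, (∃ᶠ i in atTop, t ∈ (φ i).dom) → ∃ x, (t, x) ∈ M := fun t ht => by
    obtain ⟨τ, htτ, hBτ⟩ := hB t
    exact hM.exists_mem_of_frequently_mem_dom hBτ htτ ht
  have hD : OrdConnected {t | ∃ x, (t, x) ∈ M} := by
    refine ⟨fun s hs t ht r hr => ?_⟩
    obtain ⟨x, hx⟩ := hs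
    obtain ⟨y, hy⟩ := ht
    rcases hr.2.eq_or_lt with rfl | hrt
    · exact ⟨y, hy⟩
    · exact hfib r (hM.eventually_mem_dom hy ((hM.nonneg hx).trans hr.1) hrt).frequently
  obtain ⟨χ, hdom, hgraph⟩ := hM.exists_arc hspeed (D := {t | ∃ x, (t, x) ∈ M})
    ⟨ξ, hM.zero_mem hξ⟩ hD (fun t ht => ht) (fun t _ => hB t)
  have hgraphM : χ.graph = M := by
    rw [hgraph]
    exact inter_eq_left.2 fun p hp => ⟨p.2, hp⟩
  refine ⟨χ, hH.isSolution_of_graph_subset hρ hρ0 hε hε0 hφ hM hgraphM.subset fun t _ => hB t,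
    hgraphM, ?_, tendsto_order.2 ⟨fun c hc => ?_, fun c hc => ?_⟩⟩
  · have h0 := hM.zero_mem hξ
    rw [← hgraphM] at h0
    exact h0.2.symm
  · obtain ⟨_, ⟨t, ht, rfl⟩, hct⟩ := lt_sSup_iff.1 hc
    rw [hdom] at ht
    obtain ⟨x, hx⟩ := ht
    obtain ⟨s, hcs, hst⟩ := EReal.lt_iff_exists_real_btwn.1 hct
    have hst' : s < t := EReal.coe_lt_coe_iff.1 hst
    refine (hM.eventually_exists_near hx (sub_pos.2 hst')).mono ?_
    rintro i ⟨q, hq, hqt, -⟩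
    have hsq : s < q := by linarith [(abs_lt.1 hqt).1]
    exact (hcs.trans (EReal.coe_lt_coe_iff.2 hsq)).trans_le (le_sSup ⟨q, hq, rfl⟩)
  -- a time beyond `χ.dom` that lay in infinitely many domains would carry a point of `M`
  · obtain ⟨r, hr, hrc⟩ := EReal.lt_iff_exists_real_btwn.1 hc
    have hr0 : 0 ≤ r := EReal.coe_le_coe_iff.1
      ((le_sSup ⟨0, χ.zero_mem, rfl⟩ : ((0 : ℝ) : EReal) ≤ χ.length).trans hr.le)
    have hrD : ¬ ∃ᶠ i in atTop, r ∈ (φ i).dom := fun hfr => by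
      have hmem : r ∈ χ.dom := hdom ▸ hfib r hfr
      exact absurd (le_sSup ⟨r, hmem, rfl⟩ : (r : EReal) ≤ χ.length) (not_le.2 hr)
    exact (not_frequently.1 hrD).mono fun i hi => (Arc.length_le_of_notMem_dom hr0 hi).trans_lt hrc

/-- With escape, let `T` be the supremum of the times before which the sequence is bounded. The
graphical limit is traced by a solution on `[0, T)`. Its norm tends to infinity at `T`, since
a bounded point near `T` would keep the sequence bounded beyond `T`. -/
theorem BasicConditions.exists_isMaximalSolution_of_not_locallyEventuallyBounded
    (hH : H.BasicConditions)
    (hρ : Continuous ρ) (hρ0 : ∀ x, 0 ≤ ρ x) (hε : ∀ i, ε i ∈ Ioo (0 : ℝ) 1)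
    (hε0 : Tendsto ε atTop (𝓝 0))
    (hφ : ∀ i, (H.perturbation (fun x => ε i * ρ x)).IsSolution (φ i))
    (hM : GraphConverges φ M) {ξ : E} (hξ : Tendsto (fun i => (φ i).toFun 0) atTop (𝓝 ξ))
    (hleb : ¬ LocallyEventuallyBounded φ) :
    ∃ T : ℝ, 0 < T ∧ ∃ χ : Arc E, H.IsMaximalSolution χ ∧
      χ.graph = M ∩ {p | p.1 < T} ∧ χ.length = (T : EReal) ∧
      Tendsto (fun t => ‖χ.toFun t‖) (𝓝[<] T) atTop := by
  have hspeed := hH.hasLocallyBoundedSpeed hρ hρ0 hε hφ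
  rw [locallyEventuallyBounded_iff_boundedBefore] at hleb
  push Not at hleb
  obtain ⟨τ₀, -, hτ₀⟩ := hleb
  have hbdd : BddAbove {τ | BoundedBefore φ τ} :=
    ⟨τ₀, fun τ hτ => le_of_not_gt fun hlt => hτ₀ (BoundedBefore.mono hτ hlt.le)⟩
  obtain ⟨κ, hκ, hesc⟩ := hspeed.exists_escape_time (‖ξ‖ + 1)
  have hinit : BoundedBefore φ κ := by
    refine ⟨‖ξ‖ + 1 + 1, ?_⟩
    filter_upwards [hξ.norm.eventually_le_const (lt_add_one ‖ξ‖)] with i hi t ht htκ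
    exact hesc i 0 (φ i).zero_mem hi t ht ((φ i).nonneg t ht) (by linarith)
  set T := sSup {τ | BoundedBefore φ τ}
  have hT : 0 < T := hκ.trans_le (le_csSup hbdd hinit)
  have hBlt : ∀ t < T, BoundedBefore φ t := fun t ht => by
    obtain ⟨τ, hτ, htτ⟩ := exists_lt_of_lt_csSup ⟨κ, hinit⟩ ht
    exact BoundedBefore.mono hτ htτ.le
  have hBgt : ∀ t > T, ¬ BoundedBefore φ t := fun t ht hBt => not_le.2 ht (le_csSup hbdd hBt)
  have hB : ∀ t ∈ Ico 0 T, ∃ τ, t < τ ∧ BoundedBefore φ τ := fun t ht => by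
    obtain ⟨τ, htτ, hτT⟩ := exists_between ht.2
    exact ⟨τ, htτ, hBlt τ hτT⟩
  have hfib : ∀ t ∈ Ico 0 T, ∃ x, (t, x) ∈ M := fun t ht => by
    obtain ⟨τ, htτ, hBτ⟩ := hB t ht
    refine hM.exists_mem_of_frequently_mem_dom hBτ htτ fun hcon => ?_
    -- if the domains eventually ended before `t`, boundedness before `t` would be global
    obtain ⟨R, hR⟩ := hBlt t ht.2
    refine hBgt (T + 1) (lt_add_one T) ⟨R, (hR.and hcon).mono ?_⟩
    rintro i ⟨hi, hti⟩ s hs -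
    exact hi s hs (lt_of_not_ge fun hts => hti ((φ i).mem_dom_of_le ht.1 hts hs))
  obtain ⟨χ, hdom, hgraph⟩ := hM.exists_arc hspeed (left_mem_Ico.2 hT) ordConnected_Ico hfib hB
  have hgr : ∀ t ∈ Ico 0 T, (t, χ.toFun t) ∈ M := fun t ht =>
    (hgraph.subset ⟨hdom.symm ▸ ht, rfl⟩ : (t, χ.toFun t) ∈ M ∩ {p | p.1 ∈ Ico 0 T}).1
  have hblow : Tendsto (fun t => ‖χ.toFun t‖) (𝓝[<] T) atTop := by
    refine tendsto_atTop.2 fun R => ?_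
    obtain ⟨κ', hκ', hext⟩ := hM.exists_boundedBefore_add hspeed R
    filter_upwards [Ioo_mem_nhdsLT (show max 0 (T - κ') < T from max_lt hT (by linarith))]
      with t ht
    have htD : t ∈ Ico 0 T := ⟨(le_max_left _ _).trans ht.1.le, ht.2⟩
    obtain ⟨τ, htτ, hBτ⟩ := hB t htD
    by_contra! hlt
    refine hBgt (t + κ') ?_ (hext t _ τ (hgr t htD) hlt.le hBτ htτ)
    linarith [(le_max_right _ _).trans_lt ht.1]
  refine ⟨T, hT, χ, ⟨hH.isSolution_of_graph_subset hρ hρ0 hε hε0 hφ hM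
    (hgraph.subset.trans inter_subset_left) (hdom ▸ hB), fun ψ _ hsub heq => ?_⟩, ?_, ?_, hblow⟩
  -- an extension of `χ` would be continuous, hence bounded, at `T`
  · refine Subset.antisymm (fun s hs => ?_) hsub
    rw [hdom]
    refine ⟨ψ.nonneg s hs, lt_of_not_ge fun hTs => ?_⟩
    have hTψ : T ∈ ψ.dom := ψ.mem_dom_of_le hT.le hTs hs
    have hcont : Tendsto ψ.toFun (𝓝[<] T) (𝓝 (ψ.toFun T)) :=
      ((ψ.continuousOn_Icc ψ.zero_mem hTψ hT.le) T (right_mem_Icc.2 hT.le)).mono_left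
        (nhdsWithin_le_of_mem (Icc_mem_nhdsLT hT))
    refine not_tendsto_nhds_of_tendsto_atTop hblow _ (hcont.norm.congr' ?_)
    filter_upwards [Ioo_mem_nhdsLT hT] with t ht
    rw [heq (hdom.symm ▸ Ioo_subset_Ico_self ht)]
  · rw [hgraph]
    ext p
    exact ⟨fun hp => ⟨hp.1, hp.2.2⟩, fun hp => ⟨hp.1, hM.nonneg hp.1, hp.2⟩⟩
  · refine le_antisymm (Arc.length_le_of_notMem_dom hT.le ?_) (le_of_forall_lt fun c hc => ?_)
    · rw [hdom]
      exact right_notMem_Ico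
    · obtain ⟨r, hcr, hrT⟩ := EReal.lt_iff_exists_real_btwn.1 hc
      refine (hcr.trans_le (EReal.coe_le_coe_iff.2 (le_max_left r 0))).trans_le
        (le_sSup ⟨_, ?_, rfl⟩)
      rw [hdom]
      exact ⟨le_max_right _ _, max_lt (EReal.coe_lt_coe_iff.1 hrT) hT⟩

theorem BasicConditions.wellPosed (hH : H.BasicConditions) : H.WellPosed :=
  fun _ hρ hρ0 _ _ hε hε0 _ hφ _ hM _ hξ =>
    ⟨hH.exists_isSolution_of_locallyEventuallyBounded hρ hρ0 hε hε0 hφ hM hξ,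
      hH.exists_isMaximalSolution_of_not_locallyEventuallyBounded hρ hρ0 hε hε0 hφ hM hξ⟩

end DiffInclusion

/-! ### Normal cones to superlevel sets -/

section NormalCone

variable {E : Type*} [NormedAddCommGroup E] [InnerProductSpace ℝ E]

theorem mem_tangentCone_of_eventually_mem {S : Set E} {x v : E}
    (h : ∀ᶠ t : ℝ in 𝓝[>] 0, x + t • v ∈ S) : v ∈ tangentCone S x := by
  obtain ⟨s, hs, hsub⟩ := mem_nhdsGT_iff_exists_Ioo_subset.1 h
  rw [mem_Ioi] at hs
  have hlim : Tendsto (fun i : ℕ => s / 2 * (1 / ((i : ℝ) + 1))) atTop (𝓝 0) := by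
    simpa using tendsto_one_div_add_atTop_nhds_zero_nat.const_mul (s / 2)
  have hpos : ∀ i : ℕ, 0 < s / 2 * (1 / ((i : ℝ) + 1)) := fun i => by positivity
  refine ⟨fun i => x + (s / 2 * (1 / ((i : ℝ) + 1))) • v, fun i => s / 2 * (1 / ((i : ℝ) + 1)),
    fun i => hsub ⟨hpos i, ?_⟩, hpos, ?_, hlim, ?_⟩
  · have h1 : (1 : ℝ) / (i + 1) ≤ 1 := by
      rw [div_le_one (by positivity)]
      linarith [(Nat.cast_nonneg i : (0 : ℝ) ≤ i)]
    nlinarith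
  · simpa using (hlim.smul_const v).const_add x
  · refine tendsto_const_nhds.congr fun i => ?_
    rw [add_sub_cancel_left, inv_smul_smul₀ (hpos i).ne']

theorem convex_normalCone (S : Set E) (x : E) : Convex ℝ (normalCone S x) := by
  intro η hη θ hθ a b ha hb _ v hv
  rw [inner_add_left, real_inner_smul_left, real_inner_smul_left]
  have h1 := mul_nonpos_of_nonneg_of_nonpos ha (hη v hv)
  have h2 := mul_nonpos_of_nonneg_of_nonpos hb (hθ v hv)
  linarith

theorem normalCone_eq_zero_of_mem_interior {S : Set E} {x η : E} (hx : x ∈ interior S)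
    (hη : η ∈ normalCone S x) : η = 0 := by
  have hcont : Tendsto (fun t : ℝ => x + t • η) (𝓝[>] 0) (𝓝 x) := by
    have h : Continuous fun t : ℝ => x + t • η := by fun_prop
    simpa using (h.tendsto 0).mono_left nhdsWithin_le_nhds
  have h0 := hη η (mem_tangentCone_of_eventually_mem
    (hcont.eventually (mem_interior_iff_mem_nhds.1 hx)))
  exact inner_self_eq_zero.1 (le_antisymm h0 real_inner_self_nonneg)

/-- If `η` is nonpositive on the open half-space of directions making an acute angle with `a`, then
`η` is a nonpositive multiple of `a`. This is expressed by an equation between continuous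
functions of `a` and `η`, which passes to limits. -/
theorem norm_smul_eq_neg_of_inner_nonpos {a η : E} (ha : a ≠ 0)
    (h : ∀ v, 0 < inner ℝ a v → inner ℝ η v ≤ 0) : ‖a‖ • η = -(‖η‖ • a) := by
  have hclosed : ∀ v, 0 ≤ inner ℝ a v → inner ℝ η v ≤ 0 := by
    intro v hv
    have hlim : Tendsto (fun t : ℝ => inner ℝ η (v + t • a)) (𝓝[>] 0) (𝓝 (inner ℝ η v)) := by
      have hc : Continuous fun t : ℝ => inner ℝ η (v + t • a) := by fun_prop
      simpa using (hc.tendsto 0).mono_left nhdsWithin_le_nhds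
    refine le_of_tendsto hlim ?_
    filter_upwards [self_mem_nhdsWithin] with t ht
    refine h _ ?_
    rw [inner_add_right, real_inner_smul_right]
    exact add_pos_of_nonneg_of_pos hv (mul_pos ht (real_inner_self_pos.2 ha))
  have hcs := neg_le_of_abs_le (abs_real_inner_le_norm a η)
  -- the half-space condition is tested on the vector that is to be shown to vanish
  have hv := hclosed (‖a‖ • η + ‖η‖ • a) (by
    rw [inner_add_right, real_inner_smul_right, real_inner_smul_right, real_inner_self_eq_norm_sq]
    nlinarith [norm_nonneg a])
  rw [inner_add_right, real_inner_smul_right, real_inner_smul_right, real_inner_self_eq_norm_sq,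
    real_inner_comm] at hv
  rw [← add_eq_zero_iff_eq_neg, ← norm_eq_zero, ← sq_eq_zero_iff, norm_add_sq_real, norm_smul,
    norm_smul, real_inner_smul_left, real_inner_smul_right, norm_norm, norm_norm,
    real_inner_comm]
  have hna : 0 < ‖a‖ := norm_pos_iff.2 ha
  have h1 : 0 ≤ ‖η‖ * (‖a‖ * ‖η‖ + inner ℝ a η) := mul_nonneg (norm_nonneg _) (by linarith)
  have h2 : ‖η‖ * (‖a‖ * ‖η‖ + inner ℝ a η) = 0 := le_antisymm (by linarith) h1
  linear_combination 2 * ‖a‖ * h2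

variable [CompleteSpace E]

/-- A first order expansion of `h` makes every direction `v` with `⟪∇h(x), v⟫ > 0` tangent. -/
theorem norm_gradient_smul_eq_of_mem_normalCone {h : E → ℝ} {x η : E}
    (hd : DifferentiableAt ℝ h x) (hx : h x = 0) (hg : gradient h x ≠ 0)
    (hη : η ∈ normalCone {y | 0 ≤ h y} x) :
    ‖gradient h x‖ • η = -(‖η‖ • gradient h x) := by
  refine norm_smul_eq_neg_of_inner_nonpos hg fun v hv => hη v (mem_tangentCone_of_eventually_mem ?_)
  have hline : HasDerivAt (fun t : ℝ => x + t • v) v 0 := by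
    simpa using ((hasDerivAt_id (0 : ℝ)).smul_const v).const_add x
  have hgr := hd.hasGradientAt.hasFDerivAt
  have hcomp : HasDerivAt (fun t : ℝ => h (x + t • v)) (inner ℝ (gradient h x) v) 0 := by
    have h1 : HasFDerivAt h (InnerProductSpace.toDual ℝ E (gradient h x)) (x + (0 : ℝ) • v) := by
      simpa using hgr
    exact h1.comp_hasDerivAt (0 : ℝ) hline
  filter_upwards [(hcomp.tendsto_slope.mono_left (nhdsGT_le_nhdsNE 0)).eventually_const_lt hv,
    self_mem_nhdsWithin] with t ht ht0
  simp only [slope_def_field, zero_smul, add_zero, hx, sub_zero] at ht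
  exact ((div_pos_iff_of_pos_right ht0).1 ht).le

theorem inner_gradient_nonneg_of_mem_tangentCone {h : E → ℝ} {x v : E}
    (hd : DifferentiableAt ℝ h x) (hx : h x = 0) (hv : v ∈ tangentCone {y | 0 ≤ h y} x) :
    0 ≤ inner ℝ (gradient h x) v := by
  obtain ⟨y, t, hy, ht, hyx, -, hlim⟩ := hv
  have hlim' := (hasFDerivWithinAt_univ.2 hd.hasGradientAt.hasFDerivAt).lim
    (c := fun i => (t i)⁻¹) (d := fun i => y i - x) (by simpa using hyx.sub_const x)
    (.of_forall fun _ => mem_univ _) hlim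
  refine ge_of_tendsto hlim' (.of_forall fun i => ?_)
  rw [add_sub_cancel, hx, sub_zero, smul_eq_mul]
  exact mul_nonneg (inv_nonneg.2 (ht i).le) (hy i)

/-- The normal cone to `{h ≥ 0}` has closed graph. In the interior it is trivial; near a boundary
point the normals satisfy `‖∇h‖ η = -‖η‖ ∇h`, a condition which passes to limits and
characterizes the normals at the boundary. -/
theorem isClosed_graph_normalCone {h : E → ℝ} (hh : ContDiff ℝ 1 h)
    (hg : ∀ x, h x = 0 → gradient h x ≠ 0) :
    IsClosed {p : E × E | p.1 ∈ {y | 0 ≤ h y} ∧ p.2 ∈ normalCone {y | 0 ≤ h y} p.1} := by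
  have hgc : Continuous (gradient h) :=
    (InnerProductSpace.toDual ℝ E).symm.continuous.comp (hh.continuous_fderiv (by norm_num))
  have hint : ∀ x η, 0 < h x → η ∈ normalCone {y | 0 ≤ h y} x → η = 0 := fun x η hx hη =>
    normalCone_eq_zero_of_mem_interior (mem_interior_iff_mem_nhds.2 <|
      (hh.continuous.continuousAt.eventually_const_lt hx).mono fun _ => le_of_lt) hη
  refine isClosed_of_closure_subset ?_
  rintro ⟨x, η⟩ hp
  obtain ⟨q, hq, hlim⟩ := mem_closure_iff_seq_limit.1 hp
  have hq1 : Tendsto (fun k => (q k).1) atTop (𝓝 x) := (continuous_fst.tendsto _).comp hlim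
  have hq2 : Tendsto (fun k => (q k).2) atTop (𝓝 η) := (continuous_snd.tendsto _).comp hlim
  have hx : 0 ≤ h x := ge_of_tendsto ((hh.continuous.tendsto x).comp hq1)
    (.of_forall fun k => (hq k).1)
  refine ⟨hx, ?_⟩
  rcases hx.lt_or_eq with hpos | hzero
  · have hη : η = 0 := by
      refine tendsto_nhds_unique hq2 (tendsto_const_nhds.congr' ?_)
      filter_upwards [((hh.continuous.tendsto x).comp hq1).eventually_const_lt hpos] with k hk
      exact (hint _ _ hk (hq k).2).symm
    intro v _
    simp [hη]
  · have heq : ‖gradient h x‖ • η = -(‖η‖ • gradient h x) := by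
      have hgq := (hgc.tendsto x).comp hq1
      refine tendsto_nhds_unique (hgq.norm.smul hq2)
        ((hq2.norm.smul hgq).neg.congr fun k => ?_)
      have hk0 : 0 ≤ h (q k).1 := (hq k).1
      rcases hk0.lt_or_eq with hk | hk
      · simp [hint _ _ hk (hq k).2]
      · exact (norm_gradient_smul_eq_of_mem_normalCone (hh.differentiable (by norm_num) _)
          hk.symm (hg _ hk.symm) (hq k).2).symm
    intro v hv
    have hnn := inner_gradient_nonneg_of_mem_tangentCone (hh.differentiable (by norm_num) x)
      hzero.symm hv
    have h1 : ‖gradient h x‖ * inner ℝ η v = -(‖η‖ * inner ℝ (gradient h x) v) := by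
      rw [← real_inner_smul_left, heq, inner_neg_left, real_inner_smul_left]
    have hpos : 0 < ‖gradient h x‖ := norm_pos_iff.2 (hg x hzero.symm)
    have h2 := mul_nonneg (norm_nonneg η) hnn
    exact nonpos_of_mul_nonpos_right (by linarith) hpos

end NormalCone

/-! ### The limiting differential inclusion -/

/-- Membership in `v - (P⁻¹ N_S(x) ∩ d𝔹)` in terms of `P`, without its inverse. -/
theorem mem_truncatedNormalMap_iff {n : ℕ} {P : Matrix (Fin n) (Fin n) ℝ} (hP : P.PosDef)
    {S : Set (EuclideanSpace ℝ (Fin n))} {x v w : EuclideanSpace ℝ (Fin n)} {d : ℝ} :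
    w ∈ truncatedNormalMap P S x v d ↔
      Matrix.toEuclideanLin P (v - w) ∈ normalCone S x ∧ ‖v - w‖ ≤ d := by
  have hdet : IsUnit P.det := (Matrix.isUnit_iff_isUnit_det P).1 hP.isUnit
  have h1 : ∀ y, Matrix.toEuclideanLin P (Matrix.toEuclideanLin P⁻¹ y) = y := fun y => by
    simp [Matrix.toLpLin_apply, Matrix.mulVec_mulVec, Matrix.mul_nonsing_inv P hdet]
  have h2 : ∀ y, Matrix.toEuclideanLin P⁻¹ (Matrix.toEuclideanLin P y) = y := fun y => by
    simp [Matrix.toLpLin_apply, Matrix.mulVec_mulVec, Matrix.nonsing_inv_mul P hdet]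
  constructor
  · rintro ⟨η, ⟨⟨θ, hθ, rfl⟩, hd⟩, rfl⟩
    rw [sub_sub_cancel, h1]
    exact ⟨hθ, mem_closedBall_zero_iff.1 hd⟩
  · rintro ⟨hN, hd⟩
    exact ⟨v - w, ⟨⟨_, hN, h2 _⟩, mem_closedBall_zero_iff.2 hd⟩, (sub_sub_cancel v w).symm⟩

theorem basicConditions_limitDI {m n : ℕ}
    {g : EuclideanSpace ℝ (Fin m) × EuclideanSpace ℝ (Fin n) → EuclideanSpace ℝ (Fin m)}
    {f : EuclideanSpace ℝ (Fin m) × EuclideanSpace ℝ (Fin n) → EuclideanSpace ℝ (Fin n)}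
    {P : Matrix (Fin n) (Fin n) ℝ} (hP : P.PosDef)
    {S : Set (EuclideanSpace ℝ (Fin n))} (hS : IsClosed S)
    (hN : IsClosed {p : EuclideanSpace ℝ (Fin n) × EuclideanSpace ℝ (Fin n) |
      p.1 ∈ S ∧ p.2 ∈ normalCone S p.1})
    (hf : Continuous f) (hg : Continuous g) (δ : ℝ) :
    (limitDI g f P S δ).BasicConditions := by
  have hfst := WithLp.continuous_fst 2 (EuclideanSpace ℝ (Fin m)) (EuclideanSpace ℝ (Fin n))
  have hsnd := WithLp.continuous_snd 2 (EuclideanSpace ℝ (Fin m)) (EuclideanSpace ℝ (Fin n))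
  have hpair := hfst.prodMk hsnd
  have hPc : Continuous (Matrix.toEuclideanLin P) := LinearMap.continuous_of_finiteDimensional _
  refine ⟨hS.preimage hsnd, ?_, ?_, ?_⟩
  · have hset : {p : WithLp 2 (EuclideanSpace ℝ (Fin m) × EuclideanSpace ℝ (Fin n)) ×
        WithLp 2 (EuclideanSpace ℝ (Fin m) × EuclideanSpace ℝ (Fin n)) |
        p.1 ∈ (limitDI g f P S δ).C ∧ p.2 ∈ (limitDI g f P S δ).F p.1} =
        {p | p.2.fst = g (p.1.fst, p.1.snd)} ∩
        ({p | ‖f (p.1.fst, p.1.snd) - p.2.snd‖ ≤ δ} ∩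
        (fun p => (p.1.snd, Matrix.toEuclideanLin P (f (p.1.fst, p.1.snd) - p.2.snd))) ⁻¹'
          {p | p.1 ∈ S ∧ p.2 ∈ normalCone S p.1}) := by
      ext p
      simp only [limitDI, mem_truncatedNormalMap_iff hP, mem_ofPred_eq, mem_inter_iff, mem_preimage]
      tauto
    rw [hset]
    have hfd : Continuous fun p : WithLp 2 (EuclideanSpace ℝ (Fin m) × EuclideanSpace ℝ (Fin n)) ×
        WithLp 2 (EuclideanSpace ℝ (Fin m) × EuclideanSpace ℝ (Fin n)) =>
        f (p.1.fst, p.1.snd) - p.2.snd :=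
      (hf.comp (hpair.comp continuous_fst)).sub (hsnd.comp continuous_snd)
    exact (isClosed_eq (hfst.comp continuous_snd) (hg.comp (hpair.comp continuous_fst))).inter
      ((isClosed_le hfd.norm continuous_const).inter
        (hN.preimage ((hsnd.comp continuous_fst).prodMk (hPc.comp hfd))))
  · rintro x - v ⟨hv1, hv2⟩ w ⟨hw1, hw2⟩ a b ha hb hab
    rw [mem_truncatedNormalMap_iff hP] at hv2 hw2
    refine ⟨?_, (mem_truncatedNormalMap_iff hP).2 ?_⟩
    · rw [WithLp.add_fst, WithLp.smul_fst, WithLp.smul_fst, hv1, hw1, Convex.combo_self hab]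
    · have hcomb : f (x.fst, x.snd) - (a • v + b • w).snd =
          a • (f (x.fst, x.snd) - v.snd) + b • (f (x.fst, x.snd) - w.snd) := by
        rw [WithLp.add_snd, WithLp.smul_snd, WithLp.smul_snd, smul_sub, smul_sub,
          sub_add_sub_comm, Convex.combo_self hab]
      rw [hcomb]
      refine ⟨?_, ?_⟩
      · rw [map_add, map_smul, map_smul]
        exact convex_normalCone S _ hv2.1 hw2.1 ha hb hab
      · have := convex_closedBall (0 : EuclideanSpace ℝ (Fin n)) δ
          (mem_closedBall_zero_iff.2 hv2.2) (mem_closedBall_zero_iff.2 hw2.2) ha hb hab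
        exact mem_closedBall_zero_iff.1 this
  · intro R
    obtain ⟨A, hA⟩ := (isCompact_closedBall (0 : WithLp 2 (EuclideanSpace ℝ (Fin m) ×
      EuclideanSpace ℝ (Fin n))) R).exists_bound_of_continuousOn
      ((hf.comp hpair).prodMk (hg.comp hpair)).continuousOn
    obtain ⟨V, hV⟩ := ((isCompact_closedBall (0 : EuclideanSpace ℝ (Fin m) ×
      EuclideanSpace ℝ (Fin n)) (A + |δ|)).image
      (WithLp.prod_continuous_toLp 2 _ _)).isBounded.subset_closedBall 0
    refine ⟨V, ?_⟩
    rintro x - hx v ⟨hv1, hv2⟩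
    rw [mem_truncatedNormalMap_iff hP] at hv2
    have hAx := hA x (mem_closedBall_zero_iff.2 hx)
    rw [Prod.norm_def, max_le_iff] at hAx
    obtain ⟨hfA, hgA⟩ : ‖f (x.fst, x.snd)‖ ≤ A ∧ ‖g (x.fst, x.snd)‖ ≤ A := hAx
    refine hV ⟨(v.fst, v.snd), ?_, rfl⟩
    rw [mem_closedBall_zero_iff, Prod.norm_def, max_le_iff, hv1]
    refine ⟨hgA.trans (le_add_of_nonneg_right (abs_nonneg δ)), ?_⟩
    change ‖v.snd‖ ≤ _
    have h1 := norm_sub_norm_le v.snd (f (x.fst, x.snd))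
    rw [norm_sub_rev] at h1
    linarith [hv2.2, le_abs_self δ]

theorem mainTheorem4 (m n : ℕ)
    (g : EuclideanSpace ℝ (Fin m) × EuclideanSpace ℝ (Fin n) → EuclideanSpace ℝ (Fin m))
    (f : EuclideanSpace ℝ (Fin m) × EuclideanSpace ℝ (Fin n) → EuclideanSpace ℝ (Fin n))
    (P : Matrix (Fin n) (Fin n) ℝ) (hP : P.PosDef)
    (h : EuclideanSpace ℝ (Fin n) → ℝ) (S : Set (EuclideanSpace ℝ (Fin n)))
    (hS : ConstraintAssumption h S)
    (hf : LocallyLipschitz f)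
    (hg : Continuous g) (hg' : IsLocallyBounded g)
    (δ : ℝ) (hδ : 0 ≤ δ) :
    (limitDI g f P S δ).WellPosed := by
  have hN := isClosed_graph_normalCone hS.contDiff hS.gradient_ne_zero
  rw [← hS.eq_superlevel] at hN
  exact (basicConditions_limitDI hP hS.compact.isClosed hN hf.continuous hg δ).wellPosed
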